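/- Let $\Bbbk$ be a field, let $H$ be a bialgebra over $\Bbbk$, and let $C$ be a left $H$-module coalgebra, that is, a $\Bbbk$-coalgebra with a left $H$-module structure such that $\Delta(hc)=h_{(1)}c_{(1)}\otimes h_{(2)}c_{(2)}$ and $\varepsilon(hc)=\varepsilon(h)\varepsilon(c)$ for $h\in H$, $c\in C$. Let $\mathfrak{M}^H$ and $\mathfrak{M}^C$ denote the categories of right $H$-comodules and right $C$-comodules. For $X\in\mathfrak{M}^H$ and $M\in\mathfrak{M}^C$, the vector space $X\otimes_{\Bbbk} M$ is a right $C$-comodule with coaction $x\otimes m\mapsto x_{(0)}\otimes m_{(0)}\otimes x_{(1)}m_{(1)}$. An $H$-module subcoalgebra of $C$ is a subspace $D\subseteq C$ with $\Delta(D)\subseteq D\otimes D$ and $HD\subseteq D$. A closed $\mathfrak{M}^H$-module subcategory of $\mathfrak{M}^C$ is a full subcategory $\mathcal{N}$ of $\mathfrak{M}^C$ that is closed under subobjects, quotient objects and arbitrary direct sums (the empty one included), and such that $X\otimes M\in\mathcal{N}$ for all $X\in\mathfrak{M}^H$ and $M\in\mathcal{N}$. Then there is a bijection between the set of $H$-module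 subcoalgebras of $C$ and the set of closed $\mathfrak{M}^H$-module subcategories of $\mathfrak{M}^C$. It sends $D$ to the full subcategory $$\mathfrak{M}^D=\{M\in\mathfrak{M}^C \mid \rho_M(M)\subseteq M\otimes D\},$$ where $\rho_M: M\to M\otimes C$ is the coaction, and its inverse sends $\mathcal{N}$ to the sum of all subcomodules of the right $C$-comodule $C$ (with coaction $\Delta$) that belong to $\mathcal{N}$. -/

import Mathlib

open CategoryTheory TensorProduct

universe u v

/-- A right comodule over a coalgebra `C` over a field `k`: a `k`-vector space `M` with a `k`-linear
coaction `M → M ⊗ C` that is coassociative and counital. -/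
structure RightComod (k : Type u) [Field k] (C : Type v) [AddCommGroup C] [Module k C]
    [Coalgebra k C] where
  carrier : Type v
  [addCommGroup : AddCommGroup carrier]
  [module : Module k carrier]
  coact : carrier →ₗ[k] carrier ⊗[k] C
  coassoc : (TensorProduct.assoc k carrier C C).toLinearMap ∘ₗ coact.rTensor C ∘ₗ coact =
    (Coalgebra.comul (R := k) (A := C)).lTensor carrier ∘ₗ coact
  counit : (TensorProduct.rid k carrier).toLinearMap ∘ₗ
    (Coalgebra.counit (R := k) (A := C)).lTensor carrier ∘ₗ coact = LinearMap.id

attribute [instance] RightComod.addCommGroup RightComod.module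

namespace RightComod

section

variable {k : Type u} [Field k] {C : Type v} [AddCommGroup C] [Module k C] [Coalgebra k C]

/-- Morphisms of right comodules: `k`-linear maps that commute with the coactions. -/
@[ext]
structure Hom (M N : RightComod k C) where
  toLinearMap : M.carrier →ₗ[k] N.carrier
  comm : N.coact ∘ₗ toLinearMap = toLinearMap.rTensor C ∘ₗ M.coact

/-- The category of right `C`-comodules. -/
instance : Category (RightComod k C) where
  Hom M N := Hom M N
  id M := ⟨LinearMap.id, by simp⟩
  comp f g := ⟨g.toLinearMap ∘ₗ f.toLinearMap, by
    rw [← LinearMap.comp_assoc, g.comm, LinearMap.comp_assoc, f.comm, ← LinearMap.comp_assoc,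
      LinearMap.rTensor_comp]⟩

/-- The coalgebra `C` as a right comodule over itself. -/
def regular (k : Type u) [Field k] (C : Type v) [AddCommGroup C] [Module k C] [Coalgebra k C] :
    RightComod k C where
  carrier := C
  coact := Coalgebra.comul
  coassoc := Coalgebra.coassoc
  counit := by ext c; simp

end

end RightComod

/-- `C`, a coalgebra with an action of the bialgebra `H` on its underlying vector space, is a left
`H`-module coalgebra: `Δ(h c) = h₁ c₁ ⊗ h₂ c₂` and `ε(h c) = ε(h) ε(c)`, that is, `Δ` and `ε` are
`H`-linear. -/
class ModuleCoalgebra (k : Type u) [Field k] (H : Type v) [Ring H] [Bialgebra k H]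
    (C : Type v) [AddCommGroup C] [Module k C] [Coalgebra k C] [Module H C]
    [IsScalarTower k H C] : Prop where
  comul_smul : ∀ (h : H) (c : C), Coalgebra.comul (R := k) (h • c) =
    TensorProduct.map (TensorProduct.lift (Algebra.lsmul k k C).toLinearMap)
      (TensorProduct.lift (Algebra.lsmul k k C).toLinearMap)
      (TensorProduct.tensorTensorTensorComm k H H C C
        (Coalgebra.comul (R := k) h ⊗ₜ[k] Coalgebra.comul (R := k) c))
  counit_smul : ∀ (h : H) (c : C), Coalgebra.counit (R := k) (h • c) =
    Coalgebra.counit (R := k) h * Coalgebra.counit (R := k) c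

namespace RightComod

section

variable {k : Type u} [Field k] {H : Type v} [Ring H] [Bialgebra k H]
    {C : Type v} [AddCommGroup C] [Module k C] [Coalgebra k C] [Module H C] [IsScalarTower k H C]

/-- The coaction `x ⊗ m ↦ x₀ ⊗ m₀ ⊗ x₁ m₁` of `C` on `X ⊗ M`. -/
noncomputable def actCoact (X : RightComod k H) (M : RightComod k C) :
    X.carrier ⊗[k] M.carrier →ₗ[k] (X.carrier ⊗[k] M.carrier) ⊗[k] C :=
  (TensorProduct.lift (Algebra.lsmul k k C).toLinearMap).lTensor (X.carrier ⊗[k] M.carrier) ∘ₗ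
    (TensorProduct.tensorTensorTensorComm k X.carrier H M.carrier C).toLinearMap ∘ₗ
    TensorProduct.map X.coact M.coact

theorem actCoact_coassoc [ModuleCoalgebra k H C] (X : RightComod k H) (M : RightComod k C) :
    (TensorProduct.assoc k (X.carrier ⊗[k] M.carrier) C C).toLinearMap ∘ₗ
        (actCoact X M).rTensor C ∘ₗ actCoact X M =
      (Coalgebra.comul (R := k) (A := C)).lTensor (X.carrier ⊗[k] M.carrier) ∘ₗ actCoact X M := by
  let a : H ⊗[k] C →ₗ[k] C := TensorProduct.lift (Algebra.lsmul k k C).toLinearMap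
  let Φ : (X.carrier ⊗[k] (H ⊗[k] H)) ⊗[k] (M.carrier ⊗[k] (C ⊗[k] C)) →ₗ[k]
      (X.carrier ⊗[k] M.carrier) ⊗[k] (C ⊗[k] C) :=
    (TensorProduct.map a a ∘ₗ
      (TensorProduct.tensorTensorTensorComm k H H C C).toLinearMap).lTensor _ ∘ₗ
    (TensorProduct.tensorTensorTensorComm k X.carrier (H ⊗[k] H) M.carrier
      (C ⊗[k] C)).toLinearMap
  have h1 : ∀ (s : X.carrier ⊗[k] H) (t : M.carrier ⊗[k] C),
      TensorProduct.assoc k (X.carrier ⊗[k] M.carrier) C C ((actCoact X M).rTensor C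
        (a.lTensor _ (TensorProduct.tensorTensorTensorComm k X.carrier H M.carrier C (s ⊗ₜ t)))) =
      Φ (TensorProduct.assoc k X.carrier H H (X.coact.rTensor H s) ⊗ₜ
        TensorProduct.assoc k M.carrier C C (M.coact.rTensor C t)) := by
    intro s t
    induction s with
    | zero => simp
    | add s₁ s₂ hs₁ hs₂ => simp only [TensorProduct.add_tmul, map_add, hs₁, hs₂]
    | tmul x h =>
      induction t with
      | zero => simp
      | add t₁ t₂ ht₁ ht₂ => simp only [TensorProduct.tmul_add, map_add, ht₁, ht₂]
      | tmul m c =>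
        simp only [TensorProduct.tensorTensorTensorComm_tmul, LinearMap.lTensor_tmul,
          LinearMap.rTensor_tmul, actCoact, LinearMap.comp_apply, TensorProduct.map_tmul,
          LinearEquiv.coe_coe]
        generalize X.coact x = p
        generalize M.coact m = q
        induction p with
        | zero => simp
        | add p₁ p₂ hp₁ hp₂ => simp only [TensorProduct.add_tmul, map_add, hp₁, hp₂]
        | tmul x' h' =>
          induction q with
          | zero => simp
          | add q₁ q₂ hq₁ hq₂ =>
            simp only [TensorProduct.tmul_add, TensorProduct.add_tmul, map_add, hq₁, hq₂]
          | tmul m' c' => simp [Φ, a]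
  have h2 : ∀ (s : X.carrier ⊗[k] H) (t : M.carrier ⊗[k] C),
      (Coalgebra.comul (R := k) (A := C)).lTensor _
        (a.lTensor _ (TensorProduct.tensorTensorTensorComm k X.carrier H M.carrier C (s ⊗ₜ t))) =
      Φ ((Coalgebra.comul (R := k) (A := H)).lTensor _ s ⊗ₜ
        (Coalgebra.comul (R := k) (A := C)).lTensor _ t) := by
    intro s t
    induction s with
    | zero => simp
    | add s₁ s₂ hs₁ hs₂ => simp only [TensorProduct.add_tmul, map_add, hs₁, hs₂]
    | tmul x h =>
      induction t with
      | zero => simp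
      | add t₁ t₂ ht₁ ht₂ => simp only [TensorProduct.tmul_add, map_add, ht₁, ht₂]
      | tmul m c => simp [Φ, a, ModuleCoalgebra.comul_smul]
  refine TensorProduct.ext' fun x m => ?_
  have hX := LinearMap.congr_fun X.coassoc x
  have hM := LinearMap.congr_fun M.coassoc m
  simp only [LinearMap.comp_apply, LinearEquiv.coe_coe] at hX hM
  have e : actCoact X M (x ⊗ₜ m) = a.lTensor _ (TensorProduct.tensorTensorTensorComm k X.carrier H
      M.carrier C (X.coact x ⊗ₜ M.coact m)) := by simp [actCoact, a]
  rw [LinearMap.comp_apply, LinearMap.comp_apply, LinearMap.comp_apply, e, LinearEquiv.coe_coe,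
    h1, h2, hX, hM]

theorem actCoact_counit [ModuleCoalgebra k H C] (X : RightComod k H) (M : RightComod k C) :
    (TensorProduct.rid k (X.carrier ⊗[k] M.carrier)).toLinearMap ∘ₗ
      (Coalgebra.counit (R := k) (A := C)).lTensor (X.carrier ⊗[k] M.carrier) ∘ₗ actCoact X M =
      LinearMap.id := by
  let a : H ⊗[k] C →ₗ[k] C := TensorProduct.lift (Algebra.lsmul k k C).toLinearMap
  have h1 : ∀ (s : X.carrier ⊗[k] H) (t : M.carrier ⊗[k] C),
      TensorProduct.rid k (X.carrier ⊗[k] M.carrier) ((Coalgebra.counit (R := k) (A := C)).lTensor _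
        (a.lTensor _ (TensorProduct.tensorTensorTensorComm k X.carrier H M.carrier C (s ⊗ₜ t)))) =
      TensorProduct.rid k X.carrier ((Coalgebra.counit (R := k) (A := H)).lTensor _ s) ⊗ₜ
        TensorProduct.rid k M.carrier ((Coalgebra.counit (R := k) (A := C)).lTensor _ t) := by
    intro s t
    induction s with
    | zero => simp
    | add s₁ s₂ hs₁ hs₂ => simp only [TensorProduct.add_tmul, map_add, hs₁, hs₂]
    | tmul x h =>
      induction t with
      | zero => simp
      | add t₁ t₂ ht₁ ht₂ => simp only [TensorProduct.tmul_add, map_add, ht₁, ht₂]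
      | tmul m c =>
        simp only [TensorProduct.tensorTensorTensorComm_tmul, LinearMap.lTensor_tmul,
          TensorProduct.lift.tmul, a, AlgHom.toLinearMap_apply, Algebra.lsmul_coe,
          TensorProduct.rid_tmul, ModuleCoalgebra.counit_smul]
        rw [mul_smul, TensorProduct.smul_tmul_smul, smul_smul]
  refine TensorProduct.ext' fun x m => ?_
  have hX := LinearMap.congr_fun X.counit x
  have hM := LinearMap.congr_fun M.counit m
  simp only [LinearMap.comp_apply, LinearEquiv.coe_coe, LinearMap.id_apply] at hX hM
  have e : actCoact X M (x ⊗ₜ m) = a.lTensor _ (TensorProduct.tensorTensorTensorComm k X.carrier H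
      M.carrier C (X.coact x ⊗ₜ M.coact m)) := by simp [actCoact, a]
  rw [LinearMap.comp_apply, LinearMap.comp_apply, e, LinearEquiv.coe_coe, h1, hX, hM,
    LinearMap.id_apply]

/-- The action of `𝔐ᴴ` on `𝔐ᶜ` (on objects): the comodule `X ⊗ M`. -/
noncomputable def act [ModuleCoalgebra k H C] (X : RightComod k H) (M : RightComod k C) :
    RightComod k C where
  carrier := X.carrier ⊗[k] M.carrier
  coact := actCoact X M
  coassoc := actCoact_coassoc X M
  counit := actCoact_counit X M

end

section

variable {k : Type u} [Field k] {C : Type v} [AddCommGroup C] [Module k C] [Coalgebra k C]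

/-- A closed subcategory of `𝔐ᶜ`: a full subcategory closed under subobjects, quotient objects and
arbitrary (small) direct sums, the empty one included. Being closed under subobjects, it is closed
under isomorphisms, so that it is the same as a property of objects. -/
structure IsClosedSubcategory (P : ObjectProperty (RightComod k C)) : Prop where
  subobjects : P.IsClosedUnderSubobjects
  quotients : P.IsClosedUnderQuotients
  directSums : ∀ J : Type v, P.IsClosedUnderColimitsOfShape (Discrete J)

/-- A closed `𝔐ᴴ`-module subcategory of `𝔐ᶜ`. -/
structure IsClosedModuleSubcategory (H : Type v) [Ring H] [Bialgebra k H] [Module H C]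
    [IsScalarTower k H C] [ModuleCoalgebra k H C] (P : ObjectProperty (RightComod k C)) : Prop
    extends IsClosedSubcategory P where
  act_mem : ∀ (X : RightComod k H) (M : RightComod k C), P M → P (act X M)

/-- For a subspace `D` of `C`, the full subcategory `𝔐ᴰ` of `𝔐ᶜ` that consists of the comodules `M`
whose coaction maps `M` into `M ⊗ D`. -/
def comodulesOver (D : Submodule k C) : ObjectProperty (RightComod k C) :=
  fun M => ∀ m : M.carrier, M.coact m ∈ LinearMap.range (D.subtype.lTensor M.carrier)

/-- The sum of all subcomodules of `M` that belong to the full subcategory `P`, as a subspace of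
`M`; a subcomodule is given as the image of an injective morphism of comodules. -/
def trace (P : ObjectProperty (RightComod k C)) (M : RightComod k C) : Submodule k M.carrier :=
  sSup {S | ∃ (N : RightComod k C) (f : N ⟶ M), P N ∧ Function.Injective f.toLinearMap ∧
    LinearMap.range f.toLinearMap = S}

end

end RightComod

/-- An `H`-module subcoalgebra of `C`: a subcoalgebra (a `k`-subspace `D` with `Δ(D) ⊆ D ⊗ D`) that
is also an `H`-submodule. -/
structure IsModuleSubcoalgebra {k : Type u} [Field k] (H : Type v) [Ring H] [Bialgebra k H]
    {C : Type v} [AddCommGroup C] [Module k C] [Coalgebra k C] [Module H C]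
    (D : Submodule k C) : Prop where
  comul_mem : ∀ c ∈ D, Coalgebra.comul (R := k) c ∈ LinearMap.range (TensorProduct.mapIncl D D)
  smul_mem : ∀ (h : H), ∀ c ∈ D, h • c ∈ D

namespace RightComod

section

variable {k : Type u} [Field k] {C : Type v} [AddCommGroup C] [Module k C] [Coalgebra k C]

/-! The coaction embeds `M` as a subcomodule of the cofree comodule `M ⊗ C`, a sum of copies `v ⊗ C`
of `C`; hence a closed subcategory is determined by the subcomodules of `C` in it. Let `D` be the
trace of a closed `P`. If `P M`, each functional `φ` on `M` gives a comodule map `m ↦ φ(m₀) m₁` into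
`C`, whose image lies in `D`; so every slice of `ρ(m)` lies in `D`, and `ρ(m) ∈ M ⊗ D`. Conversely,
if `ρ(M) ⊆ M ⊗ D`, then `M` embeds in a sum of images of members of `P`, so it is a subobject of a
quotient of a direct sum of members. This is `comodulesOver_trace`. In the other direction
(`trace_comodulesOver`), `D` is recovered from `𝔐ᴰ` by the counit: `c = ε(c₁) c₂`. The
`H`-structures match because `HD ⊆ D` puts `x₁ m₁` in `D` (`comodulesOver_act`), while `h ⊗ n ↦ h
f(n)` is a comodule map `H ⊗ N → C` (`actRegularHom`). -/

theorem Hom.comm_apply {M N : RightComod k C} (f : M ⟶ N) (m : M.carrier) :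
    N.coact (f.toLinearMap m) = f.toLinearMap.rTensor C (M.coact m) :=
  LinearMap.congr_fun f.comm m

theorem coassoc_apply (M : RightComod k C) (m : M.carrier) :
    TensorProduct.assoc k M.carrier C C (M.coact.rTensor C (M.coact m)) =
      (Coalgebra.comul (R := k) (A := C)).lTensor M.carrier (M.coact m) :=
  LinearMap.congr_fun M.coassoc m

theorem counit_apply (M : RightComod k C) (m : M.carrier) :
    TensorProduct.rid k M.carrier
      ((Coalgebra.counit (R := k) (A := C)).lTensor M.carrier (M.coact m)) = m :=
  LinearMap.congr_fun M.counit m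

/-! ### Transfer of comodule structures along linear maps -/

section Transport

variable {V W : Type*} [AddCommGroup V] [Module k V] [AddCommGroup W] [Module k W]
  {ρ : V →ₗ[k] V ⊗[k] C} {σ : W →ₗ[k] W ⊗[k] C} {f : V →ₗ[k] W}

-- Neither `ρ` nor `σ` is assumed coassociative, so the axiom can be carried along `f` both ways:
-- back if `f` is injective, forward if it is surjective.
omit [Coalgebra k C] in
theorem assoc_coact_comm (h : σ ∘ₗ f = f.rTensor C ∘ₗ ρ) (v : V) :
    TensorProduct.assoc k W C C (σ.rTensor C (σ (f v))) =
      f.rTensor (C ⊗[k] C) (TensorProduct.assoc k V C C (ρ.rTensor C (ρ v))) := by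
  have h' : ∀ v, σ (f v) = f.rTensor C (ρ v) := LinearMap.congr_fun h
  rw [h', ← LinearMap.rTensor_comp_apply, h, LinearMap.rTensor_comp_apply]
  generalize ρ.rTensor C (ρ v) = x
  induction x with
  | zero => simp
  | add x y hx hy => simp only [map_add, hx, hy]
  | tmul x c =>
    induction x with
    | zero => simp
    | add x y hx hy => simp only [TensorProduct.add_tmul, map_add, hx, hy]
    | tmul x d => simp

omit [Coalgebra k C] in
theorem lTensor_coact_comm {Q : Type*} [AddCommGroup Q] [Module k Q] (g : C →ₗ[k] Q)
    (h : σ ∘ₗ f = f.rTensor C ∘ₗ ρ) (v : V) :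
    g.lTensor W (σ (f v)) = f.rTensor Q (g.lTensor V (ρ v)) := by
  have h' : ∀ v, σ (f v) = f.rTensor C (ρ v) := LinearMap.congr_fun h
  rw [h', ← LinearMap.comp_apply (g.lTensor W), ← LinearMap.comp_apply (f.rTensor Q),
    LinearMap.lTensor_comp_rTensor, LinearMap.rTensor_comp_lTensor]

theorem rid_rTensor (f : V →ₗ[k] W) (x : V ⊗[k] k) :
    TensorProduct.rid k W (f.rTensor k x) = f (TensorProduct.rid k V x) := by
  induction x with
  | zero => simp
  | add x y hx hy => simp only [map_add, hx, hy]
  | tmul x c => simp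

end Transport

/-- The comodule structure on a space that embeds compatibly into a comodule. -/
def ofInjective (M : RightComod k C) {V : Type v} [AddCommGroup V] [Module k V]
    (i : V →ₗ[k] M.carrier) (hi : Function.Injective i) (ρ : V →ₗ[k] V ⊗[k] C)
    (h : M.coact ∘ₗ i = i.rTensor C ∘ₗ ρ) : RightComod k C where
  carrier := V
  coact := ρ
  coassoc := by
    ext v
    -- Everything is flat over a field, so the identity can be tested inside `M ⊗ (C ⊗ C)`.
    apply Module.Flat.rTensor_preserves_injective_linearMap (M := C ⊗[k] C) i hi
    simp only [LinearMap.comp_apply, LinearEquiv.coe_coe]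
    rw [← assoc_coact_comm h, ← lTensor_coact_comm _ h, coassoc_apply]
  counit := by
    ext v
    apply hi
    simp only [LinearMap.comp_apply, LinearEquiv.coe_coe, LinearMap.id_apply]
    rw [← rid_rTensor, ← lTensor_coact_comm _ h, counit_apply]

/-- The comodule structure on a space onto which a comodule maps compatibly. -/
def ofSurjective (M : RightComod k C) {V : Type v} [AddCommGroup V] [Module k V]
    (p : M.carrier →ₗ[k] V) (hp : Function.Surjective p) (ρ : V →ₗ[k] V ⊗[k] C)
    (h : ρ ∘ₗ p = p.rTensor C ∘ₗ M.coact) : RightComod k C where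
  carrier := V
  coact := ρ
  coassoc := by
    ext v
    obtain ⟨m, rfl⟩ := hp v
    simp only [LinearMap.comp_apply, LinearEquiv.coe_coe]
    rw [assoc_coact_comm h, lTensor_coact_comm _ h, coassoc_apply]
  counit := by
    ext v
    obtain ⟨m, rfl⟩ := hp v
    simp only [LinearMap.comp_apply, LinearEquiv.coe_coe, LinearMap.id_apply]
    rw [lTensor_coact_comm _ h, rid_rTensor, counit_apply]

/-! ### Subcomodules and quotient comodules -/

/-- A subspace of a comodule that is stable under the coaction. -/
def IsSubcomodule (M : RightComod k C) (S : Submodule k M.carrier) : Prop :=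
  ∀ m ∈ S, M.coact m ∈ LinearMap.range (S.subtype.rTensor C)

theorem IsSubcomodule.exists_coact {M : RightComod k C} {S : Submodule k M.carrier}
    (hS : IsSubcomodule M S) :
    ∃ ρ : S →ₗ[k] S ⊗[k] C, M.coact ∘ₗ S.subtype = S.subtype.rTensor C ∘ₗ ρ := by
  have inj : Function.Injective (S.subtype.rTensor C) :=
    Module.Flat.rTensor_preserves_injective_linearMap _ S.injective_subtype
  let e := LinearEquiv.ofInjective _ inj
  refine ⟨e.symm.toLinearMap ∘ₗ (M.coact ∘ₗ S.subtype).codRestrict _ fun m => hS m m.2, ?_⟩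
  ext m
  have := congrArg Subtype.val (e.apply_symm_apply ⟨M.coact m, hS m m.2⟩)
  exact this.symm

theorem IsSubcomodule.exists_hom {M : RightComod k C} {S : Submodule k M.carrier}
    (hS : IsSubcomodule M S) :
    ∃ (N : RightComod k C) (f : N ⟶ M), Function.Injective f.toLinearMap ∧
      LinearMap.range f.toLinearMap = S := by
  obtain ⟨ρ, hρ⟩ := hS.exists_coact
  exact ⟨ofInjective M S.subtype S.injective_subtype ρ hρ, ⟨S.subtype, hρ⟩, S.injective_subtype,
    S.range_subtype⟩

theorem IsSubcomodule.exists_quotient {M : RightComod k C} {S : Submodule k M.carrier}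
    (hS : IsSubcomodule M S) :
    ∃ (N : RightComod k C) (f : M ⟶ N), Function.Surjective f.toLinearMap ∧
      LinearMap.ker f.toLinearMap = S := by
  have hle : S ≤ LinearMap.ker (S.mkQ.rTensor C ∘ₗ M.coact) := fun m hm => by
    obtain ⟨x, hx⟩ := hS m hm
    rw [LinearMap.mem_ker, LinearMap.comp_apply, ← hx, ← LinearMap.rTensor_comp_apply]
    have : S.mkQ ∘ₗ S.subtype = 0 := by ext; simp
    simp [this]
  have h : S.liftQ _ hle ∘ₗ S.mkQ = S.mkQ.rTensor C ∘ₗ M.coact := S.liftQ_mkQ _ hle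
  exact ⟨ofSurjective M S.mkQ S.mkQ_surjective _ h, ⟨S.mkQ, h⟩, S.mkQ_surjective, S.ker_mkQ⟩

theorem isSubcomodule_range {M N : RightComod k C} (f : M ⟶ N) :
    IsSubcomodule N (LinearMap.range f.toLinearMap) := by
  rintro _ ⟨m, rfl⟩
  refine ⟨f.toLinearMap.rangeRestrict.rTensor C (M.coact m), ?_⟩
  rw [← LinearMap.rTensor_comp_apply, Hom.comm_apply]
  rfl

/-- By flatness the kernel of `f ⊗ C` is `ker f ⊗ C`. -/
theorem isSubcomodule_ker {M N : RightComod k C} (f : M ⟶ N) :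
    IsSubcomodule M (LinearMap.ker f.toLinearMap) := by
  intro m hm
  refine (Module.Flat.rTensor_exact C
    (LinearMap.exact_subtype_ker_map f.toLinearMap) (M.coact m)).1 ?_
  rw [← Hom.comm_apply, LinearMap.mem_ker.1 hm, map_zero]

theorem IsSubcomodule.iSup {M : RightComod k C} {ι : Sort*} {S : ι → Submodule k M.carrier}
    (hS : ∀ i, IsSubcomodule M (S i)) : IsSubcomodule M (⨆ i, S i) := by
  have : (⨆ i, S i) ≤
      (LinearMap.range ((⨆ i, S i).subtype.rTensor C)).comap M.coact := by
    refine iSup_le fun i m hm => ?_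
    obtain ⟨x, hx⟩ := hS i m hm
    refine ⟨(Submodule.inclusion (le_iSup S i)).rTensor C x, ?_⟩
    rw [← LinearMap.rTensor_comp_apply, ← hx]
    rfl
  exact this

/-! ### Monomorphisms, epimorphisms and colimits -/

/-- The zero morphism. -/
def zeroHom (M N : RightComod k C) : M ⟶ N := ⟨0, by simp⟩

theorem mono_of_injective {M N : RightComod k C} (f : M ⟶ N)
    (hf : Function.Injective f.toLinearMap) : Mono f where
  right_cancellation _ _ e := Hom.ext <| LinearMap.ext fun x =>
    hf (LinearMap.congr_fun (congrArg Hom.toLinearMap e) x)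

theorem epi_of_surjective {M N : RightComod k C} (f : M ⟶ N)
    (hf : Function.Surjective f.toLinearMap) : Epi f where
  left_cancellation _ _ e := Hom.ext <| LinearMap.ext fun x => by
    obtain ⟨m, rfl⟩ := hf x
    exact LinearMap.congr_fun (congrArg Hom.toLinearMap e) m

/-- The kernel is itself a comodule, and its inclusion becomes equal to zero after `f`. -/
theorem injective_of_mono {M N : RightComod k C} (f : M ⟶ N) [Mono f] :
    Function.Injective f.toLinearMap := by
  obtain ⟨K, i, -, hi⟩ := (isSubcomodule_ker f).exists_hom
  have e : i ≫ f = zeroHom K M ≫ f := Hom.ext <| LinearMap.ext fun x => by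
    have hx : i.toLinearMap x ∈ LinearMap.ker f.toLinearMap := hi ▸ ⟨x, rfl⟩
    exact (LinearMap.mem_ker.1 hx).trans (map_zero f.toLinearMap).symm
  have e' : i.toLinearMap = 0 := congrArg Hom.toLinearMap ((cancel_mono f).1 e)
  rw [← LinearMap.ker_eq_bot, ← hi, e', LinearMap.range_zero]

/-- The projection to `N / S` and the zero morphism agree on `S`. This serves both for epimorphisms
and for colimit cocones. -/
theorem eq_top_of_isSubcomodule {N : RightComod k C} {S : Submodule k N.carrier}
    (hS : IsSubcomodule N S)
    (h : ∀ (Q : RightComod k C) (g g' : N ⟶ Q),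
      (∀ x ∈ S, g.toLinearMap x = g'.toLinearMap x) → g = g') : S = ⊤ := by
  obtain ⟨Q, p, -, hp⟩ := hS.exists_quotient
  have e := h Q p (zeroHom N Q) fun x hx => by
    rw [← hp] at hx
    exact hx
  have e' : p.toLinearMap = 0 := congrArg Hom.toLinearMap e
  rw [← hp, e', LinearMap.ker_zero]

theorem surjective_of_epi {M N : RightComod k C} (f : M ⟶ N) [Epi f] :
    Function.Surjective f.toLinearMap := by
  rw [← LinearMap.range_eq_top]
  refine eq_top_of_isSubcomodule (isSubcomodule_range f) fun Q g g' h => ?_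
  refine (cancel_epi f).1 (Hom.ext <| LinearMap.ext fun x => h _ ⟨x, rfl⟩)

theorem iSup_range_eq_top_of_isColimit {J : Type*} [Category* J] {F : J ⥤ RightComod k C}
    {c : Limits.Cocone F} (hc : Limits.IsColimit c) :
    ⨆ j, LinearMap.range (Hom.toLinearMap (M := F.obj j) (N := c.pt) (c.ι.app j)) = ⊤ := by
  refine eq_top_of_isSubcomodule
    (IsSubcomodule.iSup fun j => isSubcomodule_range (M := F.obj j) (N := c.pt) (c.ι.app j))
    fun Q g g' h => hc.hom_ext fun j => Hom.ext <| LinearMap.ext fun x => ?_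
  exact h _ (le_iSup
    (fun j => LinearMap.range (Hom.toLinearMap (M := F.obj j) (N := c.pt) (c.ι.app j))) j ⟨x, rfl⟩)

/-! ### Direct sums of comodules -/

section DirectSum

variable {J : Type v} (N : J → RightComod k C)

open Classical in
/-- The coaction on a direct sum of comodules. -/
noncomputable def directSumCoact :
    (DirectSum J fun j => (N j).carrier) →ₗ[k] (DirectSum J fun j => (N j).carrier) ⊗[k] C :=
  DirectSum.toModule k J _ fun j =>
    (DirectSum.lof k J (fun j => (N j).carrier) j).rTensor C ∘ₗ (N j).coact

open Classical in
theorem directSumCoact_lof (j : J) : directSumCoact N ∘ₗ DirectSum.lof k J _ j =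
    (DirectSum.lof k J (fun j => (N j).carrier) j).rTensor C ∘ₗ (N j).coact := by
  ext x
  simp [directSumCoact]

open Classical in
/-- The direct sum of a family of comodules. -/
noncomputable def directSum : RightComod k C where
  carrier := DirectSum J fun j => (N j).carrier
  coact := directSumCoact N
  coassoc := by
    refine DirectSum.linearMap_ext _ fun j => LinearMap.ext fun x => ?_
    simp only [LinearMap.comp_apply, LinearEquiv.coe_coe]
    rw [assoc_coact_comm (directSumCoact_lof N j), lTensor_coact_comm _ (directSumCoact_lof N j),
      coassoc_apply]
  counit := by
    refine DirectSum.linearMap_ext _ fun j => LinearMap.ext fun x => ?_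
    simp only [LinearMap.comp_apply, LinearEquiv.coe_coe, LinearMap.id_apply]
    rw [lTensor_coact_comm _ (directSumCoact_lof N j), rid_rTensor, counit_apply]

open Classical in
/-- The inclusion of a summand. -/
noncomputable def directSumι (j : J) : N j ⟶ directSum N :=
  ⟨DirectSum.lof k J (fun j => (N j).carrier) j, directSumCoact_lof N j⟩

open Classical in
theorem directSumCoact_toModule {M : RightComod k C} (f : ∀ j, N j ⟶ M) :
    M.coact ∘ₗ DirectSum.toModule k J _ (fun j => (f j).toLinearMap) =
      (DirectSum.toModule k J _ fun j => (f j).toLinearMap).rTensor C ∘ₗ directSumCoact N := by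
  refine DirectSum.linearMap_ext _ fun j => LinearMap.ext fun x => ?_
  have h := LinearMap.congr_fun (directSumCoact_lof N j) x
  simp only [LinearMap.comp_apply] at h
  have e : (DirectSum.toModule k J M.carrier fun j => (f j).toLinearMap) ∘ₗ
      DirectSum.lof k J (fun j => (N j).carrier) j = (f j).toLinearMap := by ext; simp
  simp only [LinearMap.comp_apply, DirectSum.toModule_lof]
  rw [h, ← LinearMap.rTensor_comp_apply, e, Hom.comm_apply]

open Classical in
/-- The morphism out of a direct sum given by a family of morphisms. -/
noncomputable def directSumDesc {M : RightComod k C} (f : ∀ j, N j ⟶ M) : directSum N ⟶ M :=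
  ⟨DirectSum.toModule k J _ fun j => (f j).toLinearMap, directSumCoact_toModule N f⟩

theorem directSumι_desc {M : RightComod k C} (f : ∀ j, N j ⟶ M) (j : J) :
    directSumι N j ≫ directSumDesc N f = f j :=
  Hom.ext <| LinearMap.ext fun x => by
    classical
    exact DirectSum.toModule_lof (M := fun j => (N j).carrier) k (φ := fun j => (f j).toLinearMap)
      j x

theorem directSum_hom_ext {M : RightComod k C} {f g : directSum N ⟶ M}
    (h : ∀ j, directSumι N j ≫ f = directSumι N j ≫ g) : f = g := by
  classical
  exact Hom.ext <| DirectSum.linearMap_ext _ fun j => congrArg Hom.toLinearMap (h j)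

/-- The direct sum of comodules is their coproduct. -/
noncomputable def directSumIsColimit : Limits.IsColimit (Limits.Cofan.mk _ (directSumι N)) :=
  Limits.Cofan.IsColimit.mk _ (fun s => directSumDesc N s.inj) (fun _ j => directSumι_desc N _ j)
    fun _ _ hm => directSum_hom_ext N fun j => (hm j).trans (directSumι_desc N _ j).symm

end DirectSum

/-! ### Membership in a closed subcategory -/

namespace IsClosedSubcategory

variable {P : ObjectProperty (RightComod k C)}

theorem of_injective (hP : IsClosedSubcategory P) {M N : RightComod k C} (f : M ⟶ N)
    (hf : Function.Injective f.toLinearMap) (hN : P N) : P M :=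
  have := mono_of_injective f hf
  hP.subobjects.prop_of_mono f hN

theorem of_surjective (hP : IsClosedSubcategory P) {M N : RightComod k C} (f : M ⟶ N)
    (hf : Function.Surjective f.toLinearMap) (hM : P M) : P N :=
  have := epi_of_surjective f hf
  hP.quotients.prop_of_epi f hM

theorem directSum (hP : IsClosedSubcategory P) {J : Type v} (N : J → RightComod k C)
    (hN : ∀ j, P (N j)) : P (directSum N) :=
  have := hP.directSums J
  P.prop_of_isColimit (directSumIsColimit N) fun j => hN j.as

/-- `M` is a subobject of the image of `g`, which is a quotient of `N`. -/
theorem of_range_le (hP : IsClosedSubcategory P) {M N F : RightComod k C} (f : M ⟶ F)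
    (hf : Function.Injective f.toLinearMap) (g : N ⟶ F) (hN : P N)
    (h : LinearMap.range f.toLinearMap ≤ LinearMap.range g.toLinearMap) : P M := by
  obtain ⟨I, i, hi, hI⟩ := (isSubcomodule_range g).exists_hom
  have lift : ∀ {L : RightComod k C} (q : L ⟶ F),
      LinearMap.range q.toLinearMap ≤ LinearMap.range i.toLinearMap →
      ∃ p : L ⟶ I, i.toLinearMap ∘ₗ p.toLinearMap = q.toLinearMap := by
    intro L q hq
    obtain ⟨p, hp⟩ : ∃ p : L.carrier →ₗ[k] I.carrier, i.toLinearMap ∘ₗ p = q.toLinearMap := by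
      refine ⟨(LinearEquiv.ofInjective _ hi).symm.toLinearMap ∘ₗ
        q.toLinearMap.codRestrict _ fun x => hq ⟨x, rfl⟩, LinearMap.ext fun x => ?_⟩
      exact congrArg Subtype.val ((LinearEquiv.ofInjective _ hi).apply_symm_apply _)
    refine ⟨⟨p, LinearMap.ext fun x => ?_⟩, hp⟩
    -- Compatibility of `p` with the coactions can be checked after the injective map `i ⊗ C`.
    apply Module.Flat.rTensor_preserves_injective_linearMap (M := C) _ hi
    rw [LinearMap.comp_apply, LinearMap.comp_apply, ← LinearMap.rTensor_comp_apply, hp,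
      ← Hom.comm_apply, ← Hom.comm_apply, ← hp, LinearMap.comp_apply]
  obtain ⟨p, hp⟩ := lift f (hI ▸ h)
  obtain ⟨q, hq⟩ := lift g hI.ge
  refine hP.of_injective p (fun x y hxy => hf ?_) (hP.of_surjective q (fun x => ?_) hN)
  · rw [← hp, LinearMap.comp_apply, hxy, LinearMap.comp_apply]
  · obtain ⟨n, hn⟩ := hI.le ⟨x, rfl⟩
    exact ⟨n, hi (by rw [← hn, ← hq, LinearMap.comp_apply])⟩

theorem of_range_le_iSup (hP : IsClosedSubcategory P) {M F : RightComod k C} (f : M ⟶ F)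
    (hf : Function.Injective f.toLinearMap) {J : Type v} (N : J → RightComod k C)
    (hN : ∀ j, P (N j)) (g : ∀ j, N j ⟶ F)
    (h : LinearMap.range f.toLinearMap ≤ ⨆ j, LinearMap.range (g j).toLinearMap) : P M := by
  refine hP.of_range_le f hf (directSumDesc N g) (hP.directSum N hN)
    (h.trans (iSup_le fun j => ?_))
  rw [← directSumι_desc N g j]
  exact LinearMap.range_comp_le_range (directSumι N j).toLinearMap (directSumDesc N g).toLinearMap

/-- The image of `f` is a quotient of `N`, so the trace absorbs non-injective morphisms too. -/
theorem range_le_trace (hP : IsClosedSubcategory P) {M N : RightComod k C} (f : N ⟶ M)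
    (hN : P N) : LinearMap.range f.toLinearMap ≤ trace P M := by
  obtain ⟨I, i, hi, hI⟩ := (isSubcomodule_range f).exists_hom
  exact le_sSup ⟨I, i, hP.of_range_le i hi f hN hI.le, hi, hI⟩

end IsClosedSubcategory

end

end RightComod
-- Membership in `V ⊗ D`
theorem Submodule.mem_range_lTensor_subtype_iff {k V C : Type*} [Field k] [AddCommGroup V]
    [Module k V] [AddCommGroup C] [Module k C] (D : Submodule k C) (x : V ⊗[k] C) :
    x ∈ LinearMap.range (D.subtype.lTensor V) ↔ D.mkQ.lTensor V x = 0 :=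
  (lTensor_exact V (LinearMap.exact_subtype_mkQ D) D.mkQ_surjective x).symm

/-- The coordinate functionals of a basis of `V` detect whether an element of `V ⊗ (C / D)`
vanishes. -/
theorem Submodule.mem_range_lTensor_subtype_of_forall {k V C : Type*} [Field k] [AddCommGroup V]
    [Module k V] [AddCommGroup C] [Module k C] (D : Submodule k C) (x : V ⊗[k] C)
    (h : ∀ φ : V →ₗ[k] k, TensorProduct.lid k C (φ.rTensor C x) ∈ D) :
    x ∈ LinearMap.range (D.subtype.lTensor V) := by
  classical
  rw [D.mem_range_lTensor_subtype_iff]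
  let b := Module.Basis.ofVectorSpace k V
  apply (TensorProduct.equivFinsuppOfBasisLeft b).injective
  ext i
  have e : ∀ y : V ⊗[k] C, TensorProduct.lid k (C ⧸ D) ((b.coord i).rTensor _ (D.mkQ.lTensor V y)) =
      D.mkQ (TensorProduct.lid k C ((b.coord i).rTensor C y)) := by
    intro y
    induction y with
    | zero => simp
    | add y z hy hz => simp only [map_add, hy, hz]
    | tmul v c => simp
  rw [TensorProduct.equivFinsuppOfBasisLeft_apply, e, map_zero, Finsupp.zero_apply,
    Submodule.mkQ_apply, Submodule.Quotient.mk_eq_zero]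
  exact h _

theorem Submodule.range_lTensor_subtype_sSup_le {k V C : Type*} [Field k] [AddCommGroup V]
    [Module k V] [AddCommGroup C] [Module k C] (s : Set (Submodule k C))
    {T : Submodule k (V ⊗[k] C)} (h : ∀ v, ∀ S ∈ s, ∀ c ∈ S, v ⊗ₜ[k] c ∈ T) :
    LinearMap.range ((sSup s).subtype.lTensor V) ≤ T := by
  rintro _ ⟨x, rfl⟩
  induction x with
  | zero => simp
  | add x y hx hy => simpa only [map_add] using T.add_mem hx hy
  | tmul v c =>
    have : sSup s ≤ T.comap (TensorProduct.mk k V C v) := sSup_le fun S hS c hc => h v S hS c hc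
    exact this c.2

/-! ### Cofree comodules -/

namespace RightComod

section

variable {k : Type u} [Field k] {C : Type v} [AddCommGroup C] [Module k C] [Coalgebra k C]

/-- The coaction `v ⊗ c ↦ v ⊗ c₁ ⊗ c₂` on `V ⊗ C`. -/
noncomputable def cofreeCoact (V : Type v) [AddCommGroup V] [Module k V] :
    V ⊗[k] C →ₗ[k] (V ⊗[k] C) ⊗[k] C :=
  (TensorProduct.assoc k V C C).symm.toLinearMap ∘ₗ
    (Coalgebra.comul (R := k) (A := C)).lTensor V

/-- Each `v ⊗ C` is an image of `C`, so the comodule axioms for `V ⊗ C` reduce to the coalgebra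
axioms. -/
theorem cofreeCoact_mk {V : Type v} [AddCommGroup V] [Module k V] (v : V) :
    cofreeCoact V ∘ₗ TensorProduct.mk k V C v =
      (TensorProduct.mk k V C v).rTensor C ∘ₗ Coalgebra.comul := by
  ext c
  simp only [cofreeCoact, LinearMap.comp_apply, TensorProduct.mk_apply,
    LinearMap.lTensor_tmul, LinearEquiv.coe_coe]
  generalize Coalgebra.comul (R := k) c = x
  induction x with
  | zero => simp
  | add x y hx hy => simp only [map_add, TensorProduct.tmul_add, hx, hy]
  | tmul c d => simp

/-- The cofree comodule `V ⊗ C`. -/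
noncomputable def cofree (V : Type v) [AddCommGroup V] [Module k V] : RightComod k C where
  carrier := V ⊗[k] C
  coact := cofreeCoact V
  coassoc := TensorProduct.ext' fun v c => by
    have h := cofreeCoact_mk (k := k) (C := C) v
    simp only [LinearMap.comp_apply, LinearEquiv.coe_coe]
    rw [← TensorProduct.mk_apply, assoc_coact_comm h, lTensor_coact_comm _ h,
      Coalgebra.coassoc_apply]
  counit := TensorProduct.ext' fun v c => by
    have h := cofreeCoact_mk (k := k) (C := C) v
    simp only [LinearMap.comp_apply, LinearEquiv.coe_coe, LinearMap.id_apply]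
    rw [← TensorProduct.mk_apply, lTensor_coact_comm _ h, rid_rTensor,
      Coalgebra.lTensor_counit_comul, TensorProduct.rid_tmul, one_smul]

/-- The morphism `c ↦ v ⊗ c`. -/
noncomputable def cofreeMk {V : Type v} [AddCommGroup V] [Module k V] (v : V) :
    regular k C ⟶ cofree V :=
  ⟨TensorProduct.mk k V C v, (cofreeCoact_mk (k := k) (C := C) v :)⟩

/-- The coaction of a comodule `M`, as a morphism `M ⟶ M ⊗ C`. -/
noncomputable def coactHom (M : RightComod k C) : M ⟶ cofree M.carrier where
  toLinearMap := M.coact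
  comm := LinearMap.ext fun m =>
    (LinearEquiv.symm_apply_eq _).2 (M.coassoc_apply m).symm

theorem coact_injective (M : RightComod k C) : Function.Injective M.coact := fun x y h => by
  rw [← M.counit_apply x, h, M.counit_apply]

theorem rTensor_cofreeCoact {V : Type v} [AddCommGroup V] [Module k V] (φ : V →ₗ[k] k) :
    Coalgebra.comul ∘ₗ (TensorProduct.lid k C).toLinearMap ∘ₗ φ.rTensor C =
      ((TensorProduct.lid k C).toLinearMap ∘ₗ φ.rTensor C).rTensor C ∘ₗ cofreeCoact V := by
  refine TensorProduct.ext' fun v c => ?_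
  simp only [cofreeCoact, LinearMap.comp_apply, LinearMap.lTensor_tmul, LinearMap.rTensor_tmul,
    LinearEquiv.coe_coe, TensorProduct.lid_tmul, map_smul]
  generalize Coalgebra.comul (R := k) c = x
  induction x with
  | zero => simp
  | add x y hx hy => simp only [map_add, TensorProduct.tmul_add, smul_add, hx, hy]
  | tmul c d => simp [TensorProduct.smul_tmul']

/-- The morphism `v ⊗ c ↦ φ(v) c` of comodules. -/
noncomputable def cofreeEval {V : Type v} [AddCommGroup V] [Module k V] (φ : V →ₗ[k] k) :
    cofree V ⟶ regular k C :=
  ⟨(TensorProduct.lid k C).toLinearMap ∘ₗ φ.rTensor C, (rTensor_cofreeCoact (C := C) φ :)⟩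

/-! ### The subcategory attached to a subspace, and its trace -/

variable {D : Submodule k C}

theorem comodulesOver_iff_mkQ {M : RightComod k C} :
    comodulesOver D M ↔ ∀ m, D.mkQ.lTensor M.carrier (M.coact m) = 0 :=
  forall_congr' fun _ => D.mem_range_lTensor_subtype_iff _

theorem mkQ_lTensor_coact_hom {M N : RightComod k C} (f : M ⟶ N) (m : M.carrier) :
    D.mkQ.lTensor N.carrier (N.coact (f.toLinearMap m)) =
      f.toLinearMap.rTensor (C ⧸ D) (D.mkQ.lTensor M.carrier (M.coact m)) :=
  lTensor_coact_comm _ f.comm m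

theorem comodulesOver_of_injective {M N : RightComod k C} (f : M ⟶ N)
    (hf : Function.Injective f.toLinearMap) (hN : comodulesOver D N) : comodulesOver D M := by
  rw [comodulesOver_iff_mkQ] at hN ⊢
  intro m
  apply Module.Flat.rTensor_preserves_injective_linearMap (M := C ⧸ D) _ hf
  rw [← mkQ_lTensor_coact_hom, hN, map_zero]

/-- The condition is the vanishing of a linear map, so it can be tested on subspaces that span. One
morphism gives quotients, a cocone gives direct sums. -/
theorem comodulesOver_of_iSup_range {N : RightComod k C} {J : Type*} {M : J → RightComod k C}
    (f : ∀ j, M j ⟶ N) (hf : ⨆ j, LinearMap.range (f j).toLinearMap = ⊤)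
    (hM : ∀ j, comodulesOver D (M j)) : comodulesOver D N := by
  rw [comodulesOver_iff_mkQ]
  have h : ⨆ j, LinearMap.range (f j).toLinearMap ≤
      LinearMap.ker (D.mkQ.lTensor N.carrier ∘ₗ N.coact) := by
    refine iSup_le fun j => ?_
    rintro _ ⟨m, rfl⟩
    rw [LinearMap.mem_ker, LinearMap.comp_apply, mkQ_lTensor_coact_hom,
      comodulesOver_iff_mkQ.1 (hM j), map_zero]
  exact fun m => h (hf ▸ Submodule.mem_top)

theorem comodulesOver_isClosedSubcategory (D : Submodule k C) :
    IsClosedSubcategory (comodulesOver D) where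
  subobjects := ⟨fun f _ hY => comodulesOver_of_injective f (injective_of_mono f) hY⟩
  quotients := ⟨fun f _ hX => comodulesOver_of_iSup_range (fun _ : Unit => f)
    (by rw [iSup_const, LinearMap.range_eq_top]; exact surjective_of_epi f) fun _ => hX⟩
  directSums J := ⟨fun _ ⟨h⟩ => comodulesOver_of_iSup_range (fun j => h.ι.app j)
    (iSup_range_eq_top_of_isColimit h.isColimit) h.prop_diag_obj⟩

/-- Apply `ε ⊗ id` to `Δ(c)`. -/
theorem mem_of_comul_mem {c : C}
    (h : Coalgebra.comul (R := k) c ∈ LinearMap.range (D.subtype.lTensor C)) : c ∈ D := by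
  obtain ⟨x, hx⟩ := h
  have e : ∀ x : C ⊗[k] D, TensorProduct.lid k C
      ((Coalgebra.counit (R := k) (A := C)).rTensor C (D.subtype.lTensor C x)) ∈ D := by
    intro x
    induction x with
    | zero => simp
    | add x y hx hy => simpa only [map_add] using D.add_mem hx hy
    | tmul c d => exact D.smul_mem _ d.2
  have h := e x
  rwa [hx, Coalgebra.rTensor_counit_comul, TensorProduct.lid_tmul, one_smul] at h

theorem isSubcomodule_regular
    (hD : ∀ c ∈ D, Coalgebra.comul (R := k) c ∈ LinearMap.range (TensorProduct.mapIncl D D)) :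
    IsSubcomodule (regular k C) D := by
  intro (c : C) hc
  obtain ⟨x, hx⟩ := hD c hc
  refine ⟨D.subtype.lTensor D x, Eq.trans ?_ hx⟩
  exact LinearMap.congr_fun (LinearMap.rTensor_comp_lTensor (f := D.subtype) (g := D.subtype)) x

theorem trace_comodulesOver
    (hD : ∀ c ∈ D, Coalgebra.comul (R := k) c ∈ LinearMap.range (TensorProduct.mapIncl D D)) :
    trace (comodulesOver D) (regular k C) = D := by
  apply le_antisymm
  · refine sSup_le ?_
    rintro _ ⟨N, f, hN, -, rfl⟩
    rintro _ ⟨n, rfl⟩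
    have h : ∀ c : C, D.mkQ.lTensor C (Coalgebra.comul c) = 0 → c ∈ D := fun c hc =>
      mem_of_comul_mem ((D.mem_range_lTensor_subtype_iff _).2 hc)
    refine h _ ((mkQ_lTensor_coact_hom f n).trans ?_)
    rw [comodulesOver_iff_mkQ.1 hN, map_zero]
    rfl
  -- `D` is itself one of the subcomodules in the sum: its coaction takes values in `D ⊗ D`.
  · obtain ⟨N, f, hf, hr⟩ := (isSubcomodule_regular hD).exists_hom
    refine le_sSup ⟨N, f, comodulesOver_iff_mkQ.2 fun n => ?_, hf, hr⟩
    apply Module.Flat.rTensor_preserves_injective_linearMap (M := C ⧸ D) _ hf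
    rw [← mkQ_lTensor_coact_hom, map_zero]
    obtain ⟨x, hx⟩ := hD _ (hr.le ⟨n, rfl⟩)
    refine (D.mem_range_lTensor_subtype_iff _).1 ⟨D.subtype.rTensor D x, Eq.trans ?_ hx⟩
    exact LinearMap.congr_fun (LinearMap.lTensor_comp_rTensor (f := D.subtype) (g := D.subtype)) x

/-! ### Recovering a closed subcategory from its trace -/

/-- The sum of the subcomodules of `C` that belong to `P`, as a subspace of `C`. -/
def regularTrace (P : ObjectProperty (RightComod k C)) : Submodule k C :=
  trace P (regular k C)

namespace IsClosedSubcategory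

variable {P : ObjectProperty (RightComod k C)}

/-- The slice of `ρ(m)` along `φ` is the value at `m` of a comodule map `M → C`. -/
theorem comodulesOver_trace_of_prop (hP : IsClosedSubcategory P) {M : RightComod k C} (hM : P M) :
    comodulesOver (regularTrace P) M := fun m =>
  Submodule.mem_range_lTensor_subtype_of_forall (C := C) _ _ fun φ =>
    hP.range_le_trace (coactHom M ≫ cofreeEval (C := C) φ) hM ⟨m, rfl⟩

theorem prop_of_comodulesOver_trace (hP : IsClosedSubcategory P) {M : RightComod k C}
    (hM : comodulesOver (regularTrace P) M) : P M := by
  let s : Set (Submodule k C) := {S | ∃ (N : RightComod k C) (f : N ⟶ regular k C),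
    P N ∧ Function.Injective f.toLinearMap ∧ LinearMap.range f.toLinearMap = S}
  choose N f hN _ hr using fun S : s => S.2
  -- One summand for each vector `v` of `M` and each subcomodule `S` of `C` in `P`, mapped onto `v ⊗
  -- S`. Indexing by subspaces instead of comodules keeps the family in `Type v`.
  refine hP.of_range_le_iSup (coactHom M) M.coact_injective
    (fun j : M.carrier × s => N j.2) (fun j => hN j.2) (fun j => f j.2 ≫ cofreeMk (C := C) j.1) ?_
  rintro _ ⟨m, rfl⟩
  refine Submodule.range_lTensor_subtype_sSup_le s (fun v S hS c hc => ?_) (hM m)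
  obtain ⟨n, rfl⟩ := (hr ⟨S, hS⟩).ge hc
  exact le_iSup (fun j : M.carrier × s => LinearMap.range (f j.2 ≫ cofreeMk (C := C) j.1).toLinearMap)
    (v, ⟨S, hS⟩) ⟨n, rfl⟩

theorem comodulesOver_trace (hP : IsClosedSubcategory P) :
    comodulesOver (regularTrace P) = P :=
  funext fun _ => propext ⟨hP.prop_of_comodulesOver_trace, hP.comodulesOver_trace_of_prop⟩

/-- For `f : N ⟶ C` with `P N`, the coaction of `N` lands in `N ⊗ D` and `f` lands in `D`, so
`Δ(f(n))` lies in `D ⊗ D`. -/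
theorem comul_mem_of_mem_trace (hP : IsClosedSubcategory P) {c : C}
    (hc : c ∈ regularTrace P) : Coalgebra.comul (R := k) c ∈ LinearMap.range
      (TensorProduct.mapIncl (regularTrace P) (regularTrace P)) := by
  set D := regularTrace P
  have h : D ≤ (LinearMap.range (TensorProduct.mapIncl D D)).comap Coalgebra.comul := by
    refine sSup_le ?_
    rintro _ ⟨N, f, hN, -, rfl⟩
    rintro _ ⟨n, rfl⟩
    obtain ⟨x, hx⟩ := hP.comodulesOver_trace_of_prop hN n
    let g : N.carrier →ₗ[k] D := f.toLinearMap.codRestrict D fun n =>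
      hP.range_le_trace f hN ⟨n, rfl⟩
    have hg : f.toLinearMap = D.subtype ∘ₗ g := rfl
    refine ⟨g.rTensor D x, ?_⟩
    refine Eq.trans ?_ (f.comm_apply n).symm
    rw [← hx, ← LinearMap.comp_apply, ← LinearMap.comp_apply (f.toLinearMap.rTensor C),
      LinearMap.rTensor_comp_lTensor, hg, TensorProduct.mapIncl, LinearMap.map_comp_rTensor]
    rfl
  exact h hc

end IsClosedSubcategory

end

/-! ### Compatibility with the action of `H` -/

section

variable {k : Type u} [Field k] {H : Type v} [Ring H] [Bialgebra k H]
    {C : Type v} [AddCommGroup C] [Module k C] [Coalgebra k C] [Module H C] [IsScalarTower k H C]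

theorem comodulesOver_act [ModuleCoalgebra k H C] {D : Submodule k C}
    (hD : ∀ (h : H), ∀ c ∈ D, h • c ∈ D) (X : RightComod k H) {M : RightComod k C}
    (hM : comodulesOver D M) : comodulesOver D (act X M) := by
  have key : ∀ (s : X.carrier ⊗[k] H) (t : M.carrier ⊗[k] D),
      (TensorProduct.lift (Algebra.lsmul k k C).toLinearMap).lTensor (X.carrier ⊗[k] M.carrier)
        (TensorProduct.tensorTensorTensorComm k X.carrier H M.carrier C
          (s ⊗ₜ D.subtype.lTensor M.carrier t)) ∈
      LinearMap.range (D.subtype.lTensor (X.carrier ⊗[k] M.carrier)) := by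
    intro s t
    induction s with
    | zero => simp
    | add s₁ s₂ hs₁ hs₂ =>
      simpa only [TensorProduct.add_tmul, map_add] using Submodule.add_mem _ hs₁ hs₂
    | tmul x h =>
      induction t with
      | zero => simp
      | add t₁ t₂ ht₁ ht₂ =>
        simpa only [TensorProduct.tmul_add, map_add] using Submodule.add_mem _ ht₁ ht₂
      | tmul m d => exact ⟨(x ⊗ₜ m) ⊗ₜ ⟨h • (d : C), hD h d d.2⟩, by simp⟩
  intro (z : X.carrier ⊗[k] M.carrier)
  change actCoact X M z ∈ LinearMap.range (D.subtype.lTensor (X.carrier ⊗[k] M.carrier))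
  induction z with
  | zero => simp
  | add z w hz hw => simpa only [map_add] using Submodule.add_mem _ hz hw
  | tmul x m =>
    obtain ⟨t, ht⟩ := hM m
    have := key (X.coact x) t
    rw [ht] at this
    simpa [actCoact] using this

/-- This is `Δ(hc) = h₁ c₁ ⊗ h₂ c₂` for `c = f(m)`, with `Δ(f(m)) = f(m₀) ⊗ m₁`. -/
theorem comul_comp_lift_smul [ModuleCoalgebra k H C] {M : RightComod k C} (f : M ⟶ regular k C) :
    (regular k C).coact ∘ₗ
        (TensorProduct.lift (Algebra.lsmul k k C).toLinearMap ∘ₗ f.toLinearMap.lTensor H) =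
      (TensorProduct.lift (Algebra.lsmul k k C).toLinearMap ∘ₗ f.toLinearMap.lTensor H).rTensor C ∘ₗ
        actCoact (regular k H) M := by
  let F : M.carrier →ₗ[k] C := f.toLinearMap
  have key : ∀ (s : H ⊗[k] H) (t : M.carrier ⊗[k] C),
      TensorProduct.map (TensorProduct.lift (Algebra.lsmul k k C).toLinearMap)
        (TensorProduct.lift (Algebra.lsmul k k C).toLinearMap)
        (TensorProduct.tensorTensorTensorComm k H H C C (s ⊗ₜ F.rTensor C t)) =
      (TensorProduct.lift (Algebra.lsmul k k C).toLinearMap ∘ₗ F.lTensor H).rTensor C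
        ((TensorProduct.lift (Algebra.lsmul k k C).toLinearMap).lTensor (H ⊗[k] M.carrier)
          (TensorProduct.tensorTensorTensorComm k H H M.carrier C (s ⊗ₜ t))) := by
    intro s t
    induction s with
    | zero => simp
    | add s₁ s₂ hs₁ hs₂ => simp only [TensorProduct.add_tmul, map_add, hs₁, hs₂]
    | tmul g h =>
      induction t with
      | zero => simp
      | add t₁ t₂ ht₁ ht₂ => simp only [TensorProduct.tmul_add, map_add, ht₁, ht₂]
      | tmul m c => simp
  refine TensorProduct.ext' fun h m => ?_
  have e := key (Coalgebra.comul (R := k) h) (M.coact m)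
  have hf : Coalgebra.comul (R := k) (F m) = F.rTensor C (M.coact m) := f.comm_apply m
  rw [← hf, ← ModuleCoalgebra.comul_smul] at e
  exact e

/-- The morphism `h ⊗ m ↦ h f(m)`. -/
noncomputable def actRegularHom [ModuleCoalgebra k H C] {M : RightComod k C}
    (f : M ⟶ regular k C) : act (regular k H) M ⟶ regular k C :=
  ⟨TensorProduct.lift (Algebra.lsmul k k C).toLinearMap ∘ₗ f.toLinearMap.lTensor H,
    (comul_comp_lift_smul (H := H) f :)⟩

theorem IsClosedModuleSubcategory.isModuleSubcoalgebra_trace [ModuleCoalgebra k H C]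
    {P : ObjectProperty (RightComod k C)} (hP : IsClosedModuleSubcategory H P) :
    IsModuleSubcoalgebra H (regularTrace P) where
  comul_mem _ hc := hP.toIsClosedSubcategory.comul_mem_of_mem_trace hc
  smul_mem h c hc := by
    set D := regularTrace P
    have hle : D ≤ D.comap (Algebra.lsmul k k C h) := by
      refine sSup_le ?_
      rintro _ ⟨N, f, hN, -, rfl⟩
      rintro _ ⟨n, rfl⟩
      -- `h f(n)` is the image of `h ⊗ n`, and `H ⊗ N` is again in `P`.
      exact hP.toIsClosedSubcategory.range_le_trace (actRegularHom f)
        (hP.act_mem (regular k H) N hN) ⟨h ⊗ₜ[k] n, rfl⟩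
    exact hle hc

end

end RightComod

theorem mainTheorem4 {k : Type u} [Field k] {H : Type v} [Ring H] [Bialgebra k H]
    {C : Type v} [AddCommGroup C] [Module k C] [Coalgebra k C] [Module H C]
    [IsScalarTower k H C] [ModuleCoalgebra k H C] :
    ∃ e : {D : Submodule k C // IsModuleSubcoalgebra H D} ≃
        {P : ObjectProperty (RightComod k C) // RightComod.IsClosedModuleSubcategory H P},
      (∀ D, (e D).1 = RightComod.comodulesOver D.1) ∧
      (∀ P, (e.symm P).1 = RightComod.trace P.1 (RightComod.regular k C)) :=
  ⟨{ toFun := fun D => ⟨RightComod.comodulesOver D.1,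
        ⟨RightComod.comodulesOver_isClosedSubcategory D.1, fun X _ hM =>
          RightComod.comodulesOver_act D.2.smul_mem X hM⟩⟩
     invFun := fun P => ⟨RightComod.trace P.1 (RightComod.regular k C),
        P.2.isModuleSubcoalgebra_trace⟩
     left_inv := fun D => Subtype.ext (RightComod.trace_comodulesOver D.2.comul_mem)
     right_inv := fun P => Subtype.ext P.2.toIsClosedSubcategory.comodulesOver_trace },
    fun _ => rfl, fun _ => rfl⟩
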